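/- **Setting.** Let $\alpha_{sys}>0$. Agents $1,\dots,N$ are the nodes of a connected simple undirected graph $G=(\mathcal N,\mathcal E)$, and each plays $x$ or $y$. For a gain $\alpha>0$ let $V^\alpha(x,x)=1+\alpha$, $V^\alpha(y,y)=1$ and $V^\alpha(x,y)=V^\alpha(y,x)=0$; let $U_i^\alpha(a)=\sum_{j\sim i}V^\alpha(a_i,a_j)$, and let the welfare be $W(a)=\sum_i U_i^{\alpha_{sys}}(a)$. For utilities $(U_i)$ on a finite product $\mathcal A=\prod_i\mathcal A_i$ of nonempty action sets, *log-linear learning* with parameter $\beta>0$ is the Markov chain on $\mathcal A$ in which, at each step, a uniformly random agent $i$ replaces its action by $z\in\mathcal A_i$ with probability proportional to $\exp(\beta U_i(z,a_{-i}))$. With $\pi_\beta$ its stationary distribution, $\mathrm{LLL}(\mathcal A,(U_i))$ is the set of stochastically stable states, i.e. of those $a$ with $\lim_{\beta\to\infty}\pi_\beta(a)>0$. *Broad attacks.* A target set is a partition $S=(S_x,S_y)$ of $\mathcal N$ (either part may be empty). Put $\tilde U_i^\alpha=U_i^\alpha+\mathbf 1(a_i=y)$ for $i\in S_y$ and $\tilde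 U_i^\alpha=U_i^\alpha+(1+\alpha)\mathbf 1(a_i=x)$ for $i\in S_x$, and $$R_b(\alpha,S;G)=1-\frac{\min\{W(a):a\in \mathrm{LLL}(\{x,y\}^N,(\tilde U_i^\alpha))\}}{\max\{W(a): a\in\{x,y\}^N\}}.$$ *Focused attacks.* A fixed set $F=(F_x,F_y)$ consists of disjoint sets whose union is a nonempty proper subset of $\mathcal N$; $\mathcal A(F)$ is the set of profiles in which the agents of $F_x$ play $x$ and those of $F_y$ play $y$. Put $$R_f(\alpha,F;G)=1-\frac{\min\{W(a):a\in \mathrm{LLL}(\mathcal A(F),(U_i^\alpha))\}}{\max\{W(a):a\in\mathcal A(F)\}}.$$ Let $R_b^*(\alpha)$ be the supremum of $R_b(\alpha,S;G)$, and $R_f^*(\alpha)$ the supremum of $R_f(\alpha,F;G)$, over all $N\ge 3$, all connected graphs $G$ on $N$ nodes, and all target sets $S$, respectively all fixed sets $F$. For integers $k\ge1$ let $I_k=\left(\frac{k-1}{k},\frac{k}{k+1}\right]$. **Statement.** Let $\gamma_b\in[0,1]$ and let $\alpha>0$ satisfy $R_b^*(\alpha)\le\gamma_b$. 1. If $\alpha_{sys}\in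 I_{k_{sys}}$ for an integer $k_{sys}\ge1$, then $$R_f^*(\alpha)\ \begin{cases}\ge 0 & \text{if }\gamma_b\in\left[1-\frac{k_{sys}}{k_{sys}+1}\frac1{1+\alpha_{sys}},\,1\right],\\[4pt] >R_f^*\!\left(\frac{k}{k+1}\right) & \text{if }\gamma_b\in\left[1-\frac{k+1}{k+2}\frac1{1+\alpha_{sys}},\ 1-\frac{k}{k+1}\frac1{1+\alpha_{sys}}\right),\ k=k_{sys},k_{sys}+1,\dots,\\[4pt] \ge R_f^*(1) & \text{if }\gamma_b=1-\frac1{1+\alpha_{sys}},\\[4pt] >R_f^*\!\left(\frac32\right) & \text{if }\gamma_b\in\left[0,\,1-\frac1{1+\alpha_{sys}}\right).\end{cases}$$ 2. If $\alpha_{sys}\in[1,\frac32]$, then $R_f^*(\alpha)\ge0$ if $\gamma_b\in\left[1-\frac1{1+\alpha_{sys}},1\right]$, and $R_f^*(\alpha)>R_f^*\!\left(\frac32\right)$ if $\gamma_b\in\left[0,1-\frac1{1+\alpha_{sys}}\right)$. 3. If $\alpha_{sys}>\frac32$, then $R_f^*(\alpha)\ge0$ (for every $\gamma_b\in[0,1]$).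 -/

import Mathlib

namespace CoordGame

/-! ### Log-linear learning -/

section LogLinear

variable {ι : Type} [Fintype ι] [DecidableEq ι] {A : ι → Type} [∀ i, Fintype (A i)]
  [∀ i, DecidableEq (A i)]

/-- Probability that agent `i`, when selected at the profile `a`, chooses the action `z`,
under the utilities `U` and the rationality parameter `β`. -/
noncomputable def updateProb (U : ι → (∀ i, A i) → ℝ) (β : ℝ) (a : ∀ i, A i) (i : ι) (z : A i) : ℝ :=
  Real.exp (β * U i (Function.update a i z)) /
    ∑ z' : A i, Real.exp (β * U i (Function.update a i z'))

/-- Transition matrix of log-linear learning: one agent is selected uniformly at random and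
updates its action, all other agents repeat their previous actions. -/
noncomputable def transition (U : ι → (∀ i, A i) → ℝ) (β : ℝ) :
    Matrix (∀ i, A i) (∀ i, A i) ℝ :=
  fun a a' => ∑ i, (1 / (Fintype.card ι : ℝ)) *
    ∑ z : A i, if a' = Function.update a i z then updateProb U β a i z else 0

/-- `π` is a stationary distribution of log-linear learning. -/
def IsStationary (U : ι → (∀ i, A i) → ℝ) (β : ℝ) (π : (∀ i, A i) → ℝ) : Prop :=
  π ∈ stdSimplex ℝ (∀ i, A i) ∧ Matrix.vecMul π (transition U β) = π

/-- The set of stochastically stable states: the profiles whose probability under the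
stationary distribution `π β` has a positive limit as `β → ∞`. -/
def LLL (U : ι → (∀ i, A i) → ℝ) : Set (∀ i, A i) :=
  {a | ∃ π : ℝ → (∀ i, A i) → ℝ, (∀ β, 0 < β → IsStationary U β (π β)) ∧
    ∃ p : ℝ, 0 < p ∧ Filter.Tendsto (fun β => π β a) Filter.atTop (nhds p)}

end LogLinear

/-! ### Graphical coordination games -/

/-- The two conventions. -/
inductive Choice where
  | x
  | y
  deriving DecidableEq

instance : Fintype Choice := ⟨{Choice.x, Choice.y}, fun c => by cases c <;> decide⟩

/-- Payoff of the two-player coordination game with payoff gain `α`. -/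
def payoff (α : ℝ) : Choice → Choice → ℝ
  | Choice.x, Choice.x => 1 + α
  | Choice.y, Choice.y => 1
  | _, _ => 0

section Game

variable {N : ℕ}

open Classical in
/-- Benefit of agent `i`: the sum of the payoffs against all its neighbours in `G`. -/
noncomputable def benefit (α : ℝ) (G : SimpleGraph (Fin N)) (i : Fin N) (a : Fin N → Choice) : ℝ :=
  ∑ j with G.Adj i j, payoff α (a i) (a j)

/-- Welfare: the sum of all benefits. -/
noncomputable def welfare (α : ℝ) (G : SimpleGraph (Fin N)) (a : Fin N → Choice) : ℝ :=
  ∑ i, benefit α G i a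

/-! ### Broad attacks -/

/-- A target set: every agent gets exactly one imposter, of type `x` or of type `y`. -/
structure TargetSet (N : ℕ) where
  Sx : Finset (Fin N)
  Sy : Finset (Fin N)
  disjoint : Disjoint Sx Sy
  cover : Sx ∪ Sy = Finset.univ

/-- Perceived utilities under the target set `S`, for the operator's gain `α`. -/
noncomputable def perceivedUtility (α : ℝ) (S : TargetSet N) (G : SimpleGraph (Fin N))
    (i : Fin N) (a : Fin N → Choice) : ℝ :=
  benefit α G i a + (if i ∈ S.Sy ∧ a i = Choice.y then 1 else 0)
    + (if i ∈ S.Sx ∧ a i = Choice.x then 1 + α else 0)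

/-- Efficiency of the worst stochastically stable state under a broad attack. -/
noncomputable def broadEfficiency (αsys α : ℝ) (S : TargetSet N) (G : SimpleGraph (Fin N)) : ℝ :=
  sInf (welfare αsys G '' LLL (A := fun _ => Choice) (perceivedUtility α S G)) /
    ⨆ a : Fin N → Choice, welfare αsys G a

/-- Risk from a broad attack. -/
noncomputable def broadRisk (αsys α : ℝ) (S : TargetSet N) (G : SimpleGraph (Fin N)) : ℝ :=
  1 - broadEfficiency αsys α S G

/-! ### Focused attacks -/

/-- A fixed set: a nonempty strict subset of the agents, each committed to `x` or to `y`. -/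
structure FixedSet (N : ℕ) where
  Fx : Finset (Fin N)
  Fy : Finset (Fin N)
  disjoint : Disjoint Fx Fy
  nonempty : (Fx ∪ Fy).Nonempty
  strict : Fx ∪ Fy ⊂ Finset.univ

/-- The restricted action set of agent `i`. -/
abbrev FixedSet.Act (F : FixedSet N) (i : Fin N) : Type :=
  {c : Choice // (i ∈ F.Fx → c = Choice.x) ∧ (i ∈ F.Fy → c = Choice.y)}

/-- A restricted action profile, seen as an action profile. -/
def FixedSet.toProfile (F : FixedSet N) (a : ∀ i, F.Act i) : Fin N → Choice :=
  fun i => (a i).1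

/-- Efficiency of the worst stochastically stable state under a focused attack, relative to the
best welfare among the restricted action profiles. -/
noncomputable def focusedEfficiency (αsys α : ℝ) (F : FixedSet N) (G : SimpleGraph (Fin N)) : ℝ :=
  sInf ((fun a => welfare αsys G (F.toProfile a)) ''
      LLL (A := F.Act) (fun i a => benefit α G i (F.toProfile a))) /
    ⨆ a : ∀ i, F.Act i, welfare αsys G (F.toProfile a)

/-- Risk from a focused attack. -/
noncomputable def focusedRisk (αsys α : ℝ) (F : FixedSet N) (G : SimpleGraph (Fin N)) : ℝ :=
  1 - focusedEfficiency αsys α F G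

end Game

/-! ### Worst-case risks -/

/-- All risks from broad attacks, on connected graphs with at least three nodes. -/
def broadRisks (αsys α : ℝ) : Set ℝ :=
  {r | ∃ N : ℕ, 3 ≤ N ∧ ∃ G : SimpleGraph (Fin N), G.Connected ∧
    ∃ S : TargetSet N, r = broadRisk αsys α S G}

/-- All risks from focused attacks, on connected graphs with at least three nodes. -/
def focusedRisks (αsys α : ℝ) : Set ℝ :=
  {r | ∃ N : ℕ, 3 ≤ N ∧ ∃ G : SimpleGraph (Fin N), G.Connected ∧
    ∃ F : FixedSet N, r = focusedRisk αsys α F G}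

/-- Worst-case broad risk. -/
noncomputable def worstBroadRisk (αsys α : ℝ) : ℝ := sSup (broadRisks αsys α)

/-- Worst-case focused risk. -/
noncomputable def worstFocusedRisk (αsys α : ℝ) : ℝ := sSup (focusedRisks αsys α)

/-! The two suprema are taken over nonempty sets that are bounded above by `1`. -/

theorem welfare_nonneg {N : ℕ} {α : ℝ} (hα : 0 < α) (G : SimpleGraph (Fin N))
    (a : Fin N → Choice) : 0 ≤ welfare α G a := by
  refine Finset.sum_nonneg fun i _ => Finset.sum_nonneg fun j _ => ?_
  cases a i <;> cases a j <;> simp only [payoff] <;> linarith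

theorem broadRisks_bddAbove {αsys : ℝ} (h : 0 < αsys) (α : ℝ) :
    BddAbove (broadRisks αsys α) := by
  refine ⟨1, ?_⟩
  rintro r ⟨N, -, G, -, S, rfl⟩
  refine sub_le_self _ (div_nonneg (Real.sInf_nonneg ?_) (Real.iSup_nonneg fun a => ?_))
  · rintro _ ⟨a, -, rfl⟩
    exact welfare_nonneg h G a
  · exact welfare_nonneg h G a

theorem focusedRisks_bddAbove {αsys : ℝ} (h : 0 < αsys) (α : ℝ) :
    BddAbove (focusedRisks αsys α) := by
  refine ⟨1, ?_⟩
  rintro r ⟨N, -, G, -, F, rfl⟩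
  refine sub_le_self _ (div_nonneg (Real.sInf_nonneg ?_) (Real.iSup_nonneg fun a => ?_))
  · rintro _ ⟨a, -, rfl⟩
    exact welfare_nonneg h G _
  · exact welfare_nonneg h G _

theorem broadRisks_nonempty (αsys α : ℝ) : (broadRisks αsys α).Nonempty :=
  ⟨_, 3, le_rfl, ⊤, SimpleGraph.connected_top, ⟨∅, Finset.univ, by simp, by simp⟩, rfl⟩

theorem focusedRisks_nonempty (αsys α : ℝ) : (focusedRisks αsys α).Nonempty :=
  ⟨_, 3, le_rfl, ⊤, SimpleGraph.connected_top,
    ⟨{0}, {1}, by decide, by decide, by decide⟩, rfl⟩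

/-- The interval `((k - 1) / k, k / (k + 1)]`, used for `k ≥ 1`. -/
def gainInterval (k : ℕ) : Set ℝ := Set.Ioc (((k : ℝ) - 1) / k) ((k : ℝ) / (k + 1))

end CoordGame

/-! Half the welfare, plus the imposter terms, is an exact potential, so log-linear learning is a
reversible chain with the Gibbs measure as its stationary law, and the stochastically stable states
are the maximizers of the potential (`mem_LLL_iff`). The theorem then rests on two facts about
worst-case risks. On `[αsys, ∞)` the focused risk is strictly increasing in `α`
(`worstFocusedRisk_strictMonoOn`). It is at most `1 - (1 + αsys) / (1 + α)` by an edgewise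
comparison of welfares, and stars with committed leaves and a free center come arbitrarily close to
this value. The broad risk is bounded below by attacks on stars (`le_worstBroadRisk`): it is at
least `1 - k / (k + 1) / (1 + αsys)` when `α ≤ k / (k + 1)`, and at least `1 - 1 / (1 + αsys)` when
`α ≤ 3 / 2`. Hence a budget `γ` below one of these values pushes `α` beyond the corresponding
threshold, and monotonicity turns this into a lower bound on the focused risk. The remaining rows
only say that the focused risk is nonnegative. -/

namespace CoordGame

set_option linter.unusedSectionVars false

/-! ### Log-linear learning in potential games -/

section Potential

variable {ι : Type} [Fintype ι] [DecidableEq ι] {A : ι → Type} [∀ i, Fintype (A i)]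
  [∀ i, DecidableEq (A i)]

/-- `φ` is an exact potential of the game with utilities `U`. -/
def IsPotential (U : ι → (∀ i, A i) → ℝ) (φ : (∀ i, A i) → ℝ) : Prop :=
  ∀ i a (z : A i), φ (Function.update a i z) - U i (Function.update a i z) = φ a - U i a

/-- The Gibbs distribution of `φ` at inverse temperature `β`. -/
noncomputable def gibbs (φ : (∀ i, A i) → ℝ) (β : ℝ) (a : ∀ i, A i) : ℝ :=
  Real.exp (β * φ a) / ∑ b, Real.exp (β * φ b)

theorem gibbs_pos (φ : (∀ i, A i) → ℝ) (β : ℝ) (a : ∀ i, A i) : 0 < gibbs φ β a :=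
  div_pos (Real.exp_pos _)
    (Finset.sum_pos (fun _ _ => Real.exp_pos _) ⟨a, Finset.mem_univ a⟩)

theorem sum_gibbs [Nonempty (∀ i, A i)] (φ : (∀ i, A i) → ℝ) (β : ℝ) :
    ∑ a, gibbs φ β a = 1 := by
  simp only [gibbs]
  rw [← Finset.sum_div]
  exact div_self (Finset.sum_pos (fun _ _ => Real.exp_pos _) Finset.univ_nonempty).ne'

theorem updateProb_pos (U : ι → (∀ i, A i) → ℝ) (β : ℝ) (a : ∀ i, A i) (i : ι) (z : A i) :
    0 < updateProb U β a i z :=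
  div_pos (Real.exp_pos _)
    (Finset.sum_pos (fun _ _ => Real.exp_pos _) ⟨z, Finset.mem_univ z⟩)

theorem sum_updateProb (U : ι → (∀ i, A i) → ℝ) (β : ℝ) (a : ∀ i, A i) (i : ι) :
    ∑ z, updateProb U β a i z = 1 := by
  simp only [updateProb]
  rw [← Finset.sum_div]
  exact div_self (Finset.sum_pos (fun _ _ => Real.exp_pos _) ⟨a i, Finset.mem_univ _⟩).ne'

theorem transition_nonneg (U : ι → (∀ i, A i) → ℝ) (β : ℝ) (a b : ∀ i, A i) :
    0 ≤ transition U β a b := by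
  refine Finset.sum_nonneg fun i _ => mul_nonneg (by positivity) (Finset.sum_nonneg fun z _ => ?_)
  split_ifs
  exacts [(updateProb_pos U β a i z).le, le_rfl]

theorem transition_update_pos (U : ι → (∀ i, A i) → ℝ) (β : ℝ) (a : ∀ i, A i) (i : ι) (z : A i) :
    0 < transition U β a (Function.update a i z) := by
  have hnn : ∀ (j : ι) (w : A j), (0 : ℝ) ≤ if Function.update a i z = Function.update a j w
      then updateProb U β a j w else 0 := fun j w => by
    split_ifs
    exacts [(updateProb_pos U β a j w).le, le_rfl]
  have : Nonempty ι := ⟨i⟩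
  have hcard : (0 : ℝ) < 1 / (Fintype.card ι : ℝ) := by
    have : 0 < Fintype.card ι := Fintype.card_pos
    positivity
  refine Finset.sum_pos' (fun j _ => mul_nonneg hcard.le (Finset.sum_nonneg fun w _ => hnn j w))
    ⟨i, Finset.mem_univ i, mul_pos hcard (Finset.sum_pos' (fun w _ => hnn i w)
      ⟨z, Finset.mem_univ z, ?_⟩)⟩
  rw [if_pos rfl]
  exact updateProb_pos U β a i z

theorem sum_transition [Nonempty ι] (U : ι → (∀ i, A i) → ℝ) (β : ℝ) (a : ∀ i, A i) :
    ∑ b, transition U β a b = 1 := by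
  simp only [transition]
  rw [Finset.sum_comm]
  have h : ∀ i : ι, ∑ b : (∀ i, A i), (1 / (Fintype.card ι : ℝ)) *
      (∑ z : A i, if b = Function.update a i z then updateProb U β a i z else 0)
      = 1 / (Fintype.card ι : ℝ) := fun i => by
    rw [← Finset.mul_sum, Finset.sum_comm]
    simp [sum_updateProb]
  rw [Finset.sum_congr rfl fun i _ => h i]
  simp

/-- The Gibbs distribution satisfies detailed balance. -/
theorem gibbs_mul_transition {U : ι → (∀ i, A i) → ℝ} {φ : (∀ i, A i) → ℝ}
    (h : IsPotential U φ) (β : ℝ) (a b : ∀ i, A i) :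
    gibbs φ β a * transition U β a b = gibbs φ β b * transition U β b a := by
  simp only [transition]
  rw [Finset.mul_sum, Finset.mul_sum]
  refine Finset.sum_congr rfl fun i _ => ?_
  rw [mul_left_comm, mul_left_comm (gibbs φ β b)]
  congr 1
  -- Agent `i` contributes only if `a` and `b` agree off `i`. Its two update probabilities then have
  -- the same denominator, and the potential property matches the exponents.
  by_cases hab : b = Function.update a i (b i)
  · have hba : a = Function.update b i (a i) := by
      rw [hab]; simp
    have key : ∀ (c d : ∀ i, A i), d = Function.update c i (d i) →
        (∑ z : A i, if d = Function.update c i z then updateProb U β c i z else 0)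
          = updateProb U β c i (d i) := fun c d hcd => by
      rw [Finset.sum_eq_single (d i), if_pos hcd]
      · intro z _ hz
        refine if_neg fun hd => hz ?_
        rw [hd]; simp
      · simp
    rw [key a b hab, key b a hba]
    have hden : ∀ z, Function.update b i z = Function.update a i z := fun z => by
      rw [hab]; simp
    have hpot := h i a (b i)
    rw [← hab] at hpot
    simp only [updateProb, gibbs, ← hab, hden, Function.update_eq_self]
    rw [div_mul_div_comm, div_mul_div_comm, ← Real.exp_add, ← Real.exp_add]
    congr 2
    linear_combination (-β) * hpot
  · have hba : ∀ z, a ≠ Function.update b i z := fun z hz => hab (by rw [hz]; simp)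
    have hab' : ∀ z, b ≠ Function.update a i z := fun z hz => hab (by rw [hz]; simp)
    simp [hba, hab']

theorem gibbs_isStationary [Nonempty ι] [Nonempty (∀ i, A i)] {U : ι → (∀ i, A i) → ℝ}
    {φ : (∀ i, A i) → ℝ} (h : IsPotential U φ) (β : ℝ) : IsStationary U β (gibbs φ β) := by
  refine ⟨⟨fun a => (gibbs_pos φ β a).le, sum_gibbs φ β⟩, funext fun b => ?_⟩
  simp only [Matrix.vecMul, dotProduct]
  rw [Finset.sum_congr rfl fun a _ => gibbs_mul_transition h β a b, ← Finset.mul_sum,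
    sum_transition, mul_one]

/-- A set of profiles closed under unilateral updates is everything. -/
theorem forall_of_update {P : (∀ i, A i) → Prop} (a : ∀ i, A i) (ha : P a)
    (hP : ∀ c, P c → ∀ i (z : A i), P (Function.update c i z)) (b : ∀ i, A i) : P b := by
  have h : ∀ s : Finset ι, P (fun i => if i ∈ s then b i else a i) := fun s => by
    induction s using Finset.induction_on with
    | empty => simpa using ha
    | insert j s _ ih =>
      convert hP _ ih j (b j) using 1
      funext i
      by_cases hi : i = j
      · subst hi; simp
      · simp [hi]
  simpa using h Finset.univ

/-- The stationary distribution of log-linear learning in a potential game is unique. -/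
theorem IsStationary.eq_gibbs [Nonempty ι] [Nonempty (∀ i, A i)] {U : ι → (∀ i, A i) → ℝ}
    {φ : (∀ i, A i) → ℝ} (h : IsPotential U φ) {β : ℝ} {π : (∀ i, A i) → ℝ}
    (hπ : IsStationary U β π) : π = gibbs φ β := by
  -- By reversibility this ratio is harmonic for the chain. The maximum principle makes it constant,
  -- and normalization makes the constant `1`.
  set r : (∀ i, A i) → ℝ := fun a => π a / gibbs φ β a with hr
  have hπr : ∀ a, π a = gibbs φ β a * r a := fun a =>
    (mul_div_cancel₀ _ (gibbs_pos φ β a).ne').symm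
  have harm : ∀ b, ∑ a, transition U β b a * r a = r b := fun b => by
    have h1 := congrFun hπ.2 b
    simp only [Matrix.vecMul, dotProduct] at h1
    rw [hπr b, Finset.sum_congr rfl (fun a _ => show π a * transition U β a b
      = gibbs φ β b * (transition U β b a * r a) by
        rw [hπr a, mul_right_comm, gibbs_mul_transition h]; ring), ← Finset.mul_sum] at h1
    exact mul_left_cancel₀ (gibbs_pos φ β b).ne' h1
  obtain ⟨m, hm⟩ := Finite.exists_max r
  have hconst : ∀ b, r b = r m := by
    refine forall_of_update m rfl fun c hc i z => ?_
    have hsum : ∑ a, transition U β c a * (r m - r a) = 0 := by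
      simp only [mul_sub, Finset.sum_sub_distrib, harm, ← Finset.sum_mul, sum_transition, hc,
        one_mul, sub_self]
    have h0 := (Finset.sum_eq_zero_iff_of_nonneg fun a _ =>
      mul_nonneg (transition_nonneg U β c a) (sub_nonneg.2 (hm a))).1 hsum
      (Function.update c i z) (Finset.mem_univ _)
    rcases mul_eq_zero.1 h0 with h0 | h0
    · exact absurd h0 (transition_update_pos U β c i z).ne'
    · linarith
  have hone : r m = 1 := by
    have h1 := hπ.1.2
    rw [Finset.sum_congr rfl fun a _ => (hπr a).trans (by rw [hconst a]), ← Finset.sum_mul,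
      sum_gibbs, one_mul] at h1
    exact h1
  funext a
  rw [hπr a, hconst a, hone, mul_one]

/-- In this form, if `a` maximizes `φ`, every summand converges as `β → ∞`. -/
theorem gibbs_eq_inv (φ : (∀ i, A i) → ℝ) (β : ℝ) (a : ∀ i, A i) :
    gibbs φ β a = (∑ b, Real.exp (β * (φ b - φ a)))⁻¹ := by
  have : ∑ b, Real.exp (β * (φ b - φ a)) = (∑ b, Real.exp (β * φ b)) / Real.exp (β * φ a) := by
    rw [Finset.sum_div]
    exact Finset.sum_congr rfl fun b _ => by rw [mul_sub, Real.exp_sub]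
  rw [this, inv_div, gibbs]

open Filter Topology in
theorem tendsto_exp_mul_atTop_of_neg {c : ℝ} (hc : c < 0) :
    Tendsto (fun β : ℝ => Real.exp (β * c)) atTop (𝓝 0) :=
  Real.tendsto_exp_atBot.comp (tendsto_id.atTop_mul_const_of_neg hc)

/-- The stochastically stable states of a potential game are the maximizers of the potential. -/
theorem mem_LLL_iff [Nonempty ι] {U : ι → (∀ i, A i) → ℝ} {φ : (∀ i, A i) → ℝ}
    (h : IsPotential U φ) (a : ∀ i, A i) : a ∈ LLL U ↔ ∀ b, φ b ≤ φ a := by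
  have : Nonempty (∀ i, A i) := ⟨a⟩
  constructor
  · rintro ⟨π, hπ, p, hp, hlim⟩ b
    by_contra! hb
    refine hp.ne' (tendsto_nhds_unique hlim ?_)
    refine squeeze_zero' (g := fun β => Real.exp (β * (φ a - φ b))) ?_ ?_
      (tendsto_exp_mul_atTop_of_neg (by linarith))
    · filter_upwards [Filter.eventually_gt_atTop 0] with β hβ using (hπ β hβ).1.1 a
    · filter_upwards [Filter.eventually_gt_atTop 0] with β hβ
      rw [(hπ β hβ).eq_gibbs h, gibbs_eq_inv,
        show β * (φ a - φ b) = -(β * (φ b - φ a)) by ring, Real.exp_neg]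
      exact inv_anti₀ (Real.exp_pos _) (Finset.single_le_sum
        (f := fun c => Real.exp (β * (φ c - φ a))) (fun c _ => (Real.exp_pos _).le)
        (Finset.mem_univ b))
  · intro ha
    -- The limit is the number of maximizers of `φ`; the limiting probability of `a` is its
    -- reciprocal.
    have hlim : Filter.Tendsto (fun β : ℝ => ∑ b, Real.exp (β * (φ b - φ a))) Filter.atTop
        (nhds (∑ b, if φ b = φ a then (1 : ℝ) else 0)) := by
      refine tendsto_finsetSum _ fun b _ => ?_
      split_ifs with hb
      · simp [hb]
      · exact tendsto_exp_mul_atTop_of_neg (sub_neg.2 (lt_of_le_of_ne (ha b) hb))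
    have hpos : (0 : ℝ) < ∑ b, if φ b = φ a then (1 : ℝ) else 0 :=
      Finset.sum_pos' (fun b _ => by split_ifs <;> norm_num) ⟨a, Finset.mem_univ a, by simp⟩
    refine ⟨fun β => gibbs φ β, fun β _ => gibbs_isStationary h β, _, inv_pos.2 hpos, ?_⟩
    simp only [gibbs_eq_inv]
    exact hlim.inv₀ hpos.ne'

theorem LLL_nonempty [Nonempty ι] [Nonempty (∀ i, A i)] {U : ι → (∀ i, A i) → ℝ}
    {φ : (∀ i, A i) → ℝ} (h : IsPotential U φ) : (LLL U).Nonempty := by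
  obtain ⟨m, hm⟩ := Finite.exists_max φ
  exact ⟨m, (mem_LLL_iff h m).2 hm⟩

end Potential

/-! ### The potential of graphical coordination games -/

theorem payoff_comm (α : ℝ) (c d : Choice) : payoff α c d = payoff α d c := by
  cases c <;> cases d <;> rfl

theorem sum_sum_eq_of_symm {κ : Type*} [Fintype κ] [DecidableEq κ] (f : κ → κ → ℝ)
    (hf : ∀ i j, f i j = f j i) (k : κ) (hk : f k k = 0) :
    ∑ i, ∑ j, f i j
      = 2 * ∑ j, f k j + ∑ i ∈ Finset.univ.erase k, ∑ j ∈ Finset.univ.erase k, f i j := by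
  have h1 : ∑ i, f i k = ∑ j, f k j := Finset.sum_congr rfl fun i _ => hf i k
  have h2 := Finset.sum_erase_add Finset.univ (fun i => f i k) (Finset.mem_univ k)
  rw [← Finset.sum_erase_add _ _ (Finset.mem_univ k), Finset.sum_congr rfl fun i _ =>
    (Finset.sum_erase_add Finset.univ (f i) (Finset.mem_univ k)).symm, Finset.sum_add_distrib]
  linarith

section Welfare

variable {N : ℕ}

open Classical in
-- Welfare counts each edge twice. The edges at `i` make up its benefit, and the others do not see
-- its action.
theorem welfare_sub_benefit_update (α : ℝ) (G : SimpleGraph (Fin N)) (a : Fin N → Choice)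
    (i : Fin N) (z : Choice) :
    welfare α G (Function.update a i z) / 2 - benefit α G i (Function.update a i z)
      = welfare α G a / 2 - benefit α G i a := by
  have key : ∀ b : Fin N → Choice, welfare α G b / 2 - benefit α G i b
      = (∑ k ∈ Finset.univ.erase i, ∑ j ∈ Finset.univ.erase i,
          if G.Adj k j then payoff α (b k) (b j) else 0) / 2 := fun b => by
    have h := sum_sum_eq_of_symm (fun k j => if G.Adj k j then payoff α (b k) (b j) else 0)
      (fun k j => by rw [G.adj_comm, payoff_comm]) i (by simp)
    simp only [welfare, benefit, Finset.sum_filter]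
    linarith
  rw [key, key]
  congr 1
  refine Finset.sum_congr rfl fun k hk => Finset.sum_congr rfl fun j hj => ?_
  rw [Function.update_of_ne (Finset.ne_of_mem_erase hk),
    Function.update_of_ne (Finset.ne_of_mem_erase hj)]

/-- The contribution of the imposters of agent `i` to its perceived utility. -/
noncomputable def imposterBonus (α : ℝ) (S : TargetSet N) (i : Fin N) (c : Choice) : ℝ :=
  (if i ∈ S.Sy ∧ c = Choice.y then 1 else 0) + (if i ∈ S.Sx ∧ c = Choice.x then 1 + α else 0)

theorem perceivedUtility_isPotential (α : ℝ) (S : TargetSet N) (G : SimpleGraph (Fin N)) :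
    IsPotential (A := fun _ => Choice) (perceivedUtility α S G)
      (fun a => welfare α G a / 2 + ∑ i, imposterBonus α S i (a i)) := by
  intro i a z
  have h := welfare_sub_benefit_update α G a i z
  have hs : ∀ b : Fin N → Choice, ∑ j, imposterBonus α S j (b j)
      = imposterBonus α S i (b i) + ∑ j ∈ Finset.univ.erase i, imposterBonus α S j (b j) :=
    fun b => (Finset.add_sum_erase _ _ (Finset.mem_univ i)).symm
  have he : ∑ j ∈ Finset.univ.erase i, imposterBonus α S j (Function.update a i z j)
      = ∑ j ∈ Finset.univ.erase i, imposterBonus α S j (a j) :=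
    Finset.sum_congr rfl fun j hj => by rw [Function.update_of_ne (Finset.ne_of_mem_erase hj)]
  have hu : ∀ b, perceivedUtility α S G i b = benefit α G i b + imposterBonus α S i (b i) :=
    fun b => add_assoc _ _ _
  simp only [hs, hu, he]
  linarith

theorem FixedSet.toProfile_update (F : FixedSet N) (a : ∀ i, F.Act i) (i : Fin N) (z : F.Act i) :
    F.toProfile (Function.update a i z) = Function.update (F.toProfile a) i z.1 := by
  funext j
  by_cases h : j = i
  · subst h; simp [FixedSet.toProfile]
  · simp [FixedSet.toProfile, h]

theorem benefit_isPotential (α : ℝ) (F : FixedSet N) (G : SimpleGraph (Fin N)) :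
    IsPotential (A := F.Act) (fun i a => benefit α G i (F.toProfile a))
      (fun a => welfare α G (F.toProfile a) / 2) := by
  intro i a z
  simp only [F.toProfile_update]
  exact welfare_sub_benefit_update α G _ i _

/-- Extension of a partial profile on the free agents by the commitments of `F`. -/
def FixedSet.extend (F : FixedSet N) (c : Fin N → Choice) : ∀ i, F.Act i := fun i =>
  if hx : i ∈ F.Fx then ⟨Choice.x, fun _ => rfl, fun hy =>
      absurd hy (Finset.disjoint_left.1 F.disjoint hx)⟩
  else if hy : i ∈ F.Fy then ⟨Choice.y, fun h => absurd h hx, fun _ => rfl⟩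
  else ⟨c i, fun h => absurd h hx, fun h => absurd h hy⟩

instance (F : FixedSet N) : Nonempty (∀ i, F.Act i) := ⟨F.extend fun _ => Choice.x⟩

theorem mem_focused_LLL_iff [NeZero N] (α : ℝ) (F : FixedSet N) (G : SimpleGraph (Fin N))
    (a : ∀ i, F.Act i) :
    a ∈ LLL (A := F.Act) (fun i a => benefit α G i (F.toProfile a)) ↔
      ∀ b, welfare α G (F.toProfile b) ≤ welfare α G (F.toProfile a) := by
  rw [mem_LLL_iff (benefit_isPotential α F G)]
  exact forall_congr' fun b => div_le_div_iff_of_pos_right two_pos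

/-! ### Bounds on single risks -/

theorem focusedRisk_nonneg [NeZero N] {αsys : ℝ} (h : 0 < αsys) (α : ℝ) (F : FixedSet N)
    (G : SimpleGraph (Fin N)) : 0 ≤ focusedRisk αsys α F G := by
  obtain ⟨a, ha⟩ := LLL_nonempty (benefit_isPotential α F G)
  refine sub_nonneg.2 (div_le_one_of_le₀ ?_ (Real.iSup_nonneg fun a => welfare_nonneg h G _))
  exact (csInf_le (Set.toFinite _).bddBelow (Set.mem_image_of_mem _ ha)).trans
    (le_ciSup (f := fun a : ∀ i, F.Act i => welfare αsys G (F.toProfile a))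
      (Set.finite_range _).bddAbove a)

/-- Any stable `a` bounds the minimum from above and any feasible `b` bounds the maximum from below,
so no optimum need be computed. -/
theorem le_focusedRisk {αsys : ℝ} {α : ℝ} {F : FixedSet N} {G : SimpleGraph (Fin N)}
    {a b : ∀ i, F.Act i}
    (ha : a ∈ LLL (A := F.Act) (fun i a => benefit α G i (F.toProfile a)))
    (hw : 0 ≤ welfare αsys G (F.toProfile a)) (hb : 0 < welfare αsys G (F.toProfile b)) :
    1 - welfare αsys G (F.toProfile a) / welfare αsys G (F.toProfile b)
      ≤ focusedRisk αsys α F G := by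
  refine sub_le_sub_left (div_le_div₀ hw ?_ hb ?_) 1
  · exact csInf_le (Set.toFinite _).bddBelow
      (Set.mem_image_of_mem (fun a => welfare αsys G (F.toProfile a)) ha)
  · exact le_ciSup (f := fun a : ∀ i, F.Act i => welfare αsys G (F.toProfile a))
      (Set.finite_range _).bddAbove b

theorem le_broadRisk {αsys : ℝ} {α : ℝ} {S : TargetSet N} {G : SimpleGraph (Fin N)}
    {a b : Fin N → Choice} (ha : a ∈ LLL (A := fun _ => Choice) (perceivedUtility α S G))
    (hw : 0 ≤ welfare αsys G a) (hb : 0 < welfare αsys G b) :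
    1 - welfare αsys G a / welfare αsys G b ≤ broadRisk αsys α S G := by
  refine sub_le_sub_left (div_le_div₀ hw ?_ hb ?_) 1
  · exact csInf_le (Set.toFinite _).bddBelow (Set.mem_image_of_mem (welfare αsys G) ha)
  · exact le_ciSup (f := welfare αsys G) (Set.finite_range _).bddAbove b

theorem welfare_mono {α α' : ℝ} (h : α ≤ α') (G : SimpleGraph (Fin N)) (a : Fin N → Choice) :
    welfare α G a ≤ welfare α' G a := by
  refine Finset.sum_le_sum fun i _ => Finset.sum_le_sum fun j _ => ?_
  cases a i <;> cases a j <;> simp only [payoff] <;> linarith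

theorem mul_welfare_le {α α' : ℝ} (h : α ≤ α') (G : SimpleGraph (Fin N)) (a : Fin N → Choice) :
    (1 + α) * welfare α' G a ≤ (1 + α') * welfare α G a := by
  simp only [welfare, benefit, Finset.mul_sum]
  refine Finset.sum_le_sum fun i _ => Finset.sum_le_sum fun j _ => ?_
  cases a i <;> cases a j <;> simp only [payoff] <;> linarith

open Classical in
theorem welfare_pos_of_adj {α : ℝ} (hα : 0 < α) {G : SimpleGraph (Fin N)} {a : Fin N → Choice}
    {i j : Fin N} (hij : G.Adj i j) (h : a i = a j) : 0 < welfare α G a := by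
  have hnn : ∀ c d, 0 ≤ payoff α c d := fun c d => by
    cases c <;> cases d <;> simp only [payoff] <;> linarith
  refine Finset.sum_pos' (fun k _ => Finset.sum_nonneg fun l _ => hnn _ _)
    ⟨i, Finset.mem_univ i, Finset.sum_pos' (fun l _ => hnn _ _) ⟨j, by simpa using hij, ?_⟩⟩
  rw [h]
  cases a j <;> simp only [payoff] <;> linarith

/-- A free agent copies a neighbour. This keeps the denominator of the efficiency away from `0`,
where the convention for division would give risk `1`. -/
theorem exists_welfare_pos {α : ℝ} (hα : 0 < α) (hN : 3 ≤ N) {G : SimpleGraph (Fin N)}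
    (hG : G.Connected) (F : FixedSet N) : ∃ a, 0 < welfare α G (F.toProfile a) := by
  obtain ⟨i, -, hi⟩ := Finset.exists_of_ssubset F.strict
  have : Nontrivial (Fin N) := Fin.nontrivial_iff_two_le.2 (by omega)
  obtain ⟨j, hij⟩ := hG.preconnected.exists_adj_of_nontrivial i
  let a₀ := F.extend fun _ => Choice.x
  refine ⟨Function.update a₀ i ⟨(a₀ j).1, fun h => absurd (Finset.mem_union_left _ h) hi,
    fun h => absurd (Finset.mem_union_right _ h) hi⟩, welfare_pos_of_adj hα hij ?_⟩
  rw [F.toProfile_update, Function.update_self, Function.update_of_ne hij.ne']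
  rfl

/-- A stable `a` maximizes the welfare for gain `α`, which dominates that for `αsys` and exceeds it
by a factor of at most `(1 + α) / (1 + αsys)`. -/
theorem focusedRisk_le {αsys α : ℝ} (hαsys : 0 < αsys) (hα : αsys ≤ α) (hN : 3 ≤ N)
    {G : SimpleGraph (Fin N)} (hG : G.Connected) (F : FixedSet N) :
    focusedRisk αsys α F G ≤ 1 - (1 + αsys) / (1 + α) := by
  have : NeZero N := ⟨by omega⟩
  obtain ⟨b₀, hb₀⟩ := exists_welfare_pos hαsys hN hG F
  obtain ⟨b, hb⟩ := exists_eq_ciSup_of_finite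
    (f := fun a : ∀ i, F.Act i => welfare αsys G (F.toProfile a))
  have hpos : 0 < welfare αsys G (F.toProfile b) := hb₀.trans_le (hb ▸ le_ciSup
    (f := fun a : ∀ i, F.Act i => welfare αsys G (F.toProfile a))
      (Set.finite_range _).bddAbove b₀)
  refine sub_le_sub_left ?_ 1
  rw [focusedEfficiency, ← hb, le_div_iff₀ hpos]
  refine le_csInf ((LLL_nonempty (benefit_isPotential α F G)).image _) ?_
  rintro _ ⟨a, ha, rfl⟩
  rw [mem_focused_LLL_iff] at ha
  rw [div_mul_eq_mul_div, div_le_iff₀ (by linarith), mul_comm _ (1 + α)]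
  refine le_trans ?_ (mul_welfare_le hα G _)
  exact mul_le_mul_of_nonneg_left ((welfare_mono hα G _).trans (ha b)) (by linarith)

end Welfare

/-! ### Attacks on star graphs -/

open Classical in
theorem welfare_starGraph {n : ℕ} (α : ℝ) (a : Fin (n + 1) → Choice) :
    welfare α (SimpleGraph.starGraph 0) a = 2 * ∑ l : Fin n, payoff α (a 0) (a l.succ) := by
  have h0 : benefit α (SimpleGraph.starGraph 0) 0 a = ∑ l : Fin n, payoff α (a 0) (a l.succ) := by
    simp only [benefit, Finset.sum_filter]
    rw [Fin.sum_univ_succ]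
    simp [SimpleGraph.starGraph_adj, (Fin.succ_ne_zero _).symm]
  have hs : ∀ l : Fin n, benefit α (SimpleGraph.starGraph 0) l.succ a
      = payoff α (a 0) (a l.succ) := fun l => by
    simp only [benefit, Finset.sum_filter]
    rw [Fin.sum_univ_succ, payoff_comm]
    simp [SimpleGraph.starGraph_adj]
  rw [welfare, Fin.sum_univ_succ, h0, Finset.sum_congr rfl fun l _ => hs l]
  ring

/-- The profile on the star with `p + q` leaves in which the center and the first `p` leaves
play `y`, and the last `q` leaves play `x`. -/
def starProfile (p q : ℕ) : Fin (p + q + 1) → Choice :=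
  Fin.cons (α := fun _ => Choice) Choice.y
    (Fin.append (fun _ : Fin p => Choice.y) (fun _ : Fin q => Choice.x))

theorem starProfile_zero (p q : ℕ) : starProfile p q 0 = Choice.y := rfl

theorem starProfile_castAdd (p q : ℕ) (l : Fin p) :
    starProfile p q (l.castAdd q).succ = Choice.y := by
  simp [starProfile]

theorem starProfile_natAdd (p q : ℕ) (l : Fin q) :
    starProfile p q (l.natAdd p).succ = Choice.x := by
  simp [starProfile]

theorem welfare_starProfile (α : ℝ) (p q : ℕ) :
    welfare α (SimpleGraph.starGraph 0) (starProfile p q) = 2 * p := by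
  simp [welfare_starGraph, Fin.sum_univ_add, starProfile_zero, starProfile_castAdd,
    starProfile_natAdd, payoff]

theorem welfare_starProfile_update (α : ℝ) (p q : ℕ) :
    welfare α (SimpleGraph.starGraph 0) (Function.update (starProfile p q) 0 Choice.x)
      = 2 * (q * (1 + α)) := by
  simp [welfare_starGraph, Fin.sum_univ_add, starProfile_castAdd, starProfile_natAdd, payoff]
  ring

/-- The target set in which every agent is attacked by an imposter of the type given by `s`. -/
def TargetSet.ofProfile {N : ℕ} (s : Fin N → Choice) : TargetSet N where
  Sx := Finset.univ.filter fun i => s i = Choice.x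
  Sy := Finset.univ.filter fun i => s i = Choice.y
  disjoint := Finset.disjoint_filter.2 fun i _ h => by simp [h]
  cover := by
    ext i
    cases h : s i <;> simp [h]

/-- An imposter acts as one more neighbour frozen at `s i`. -/
theorem imposterBonus_ofProfile {N : ℕ} (α : ℝ) (s : Fin N → Choice) (i : Fin N) (c : Choice) :
    imposterBonus α (TargetSet.ofProfile s) i c = payoff α (s i) c := by
  cases h : s i <;> cases c <;> simp [imposterBonus, TargetSet.ofProfile, h, payoff]

/-- Once the center's action is fixed, the leaves optimize separately. The best potential is `1 + 2p
+ q(1 + α)` with the center at `y` and `(p + 2q)(1 + α)` with it at `x`; the hypothesis compares the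
two. -/
theorem starProfile_mem_LLL {α : ℝ} (hα : 0 < α) {p q : ℕ}
    (h : (1 + α) * (p + q) ≤ 1 + 2 * p) :
    starProfile p q ∈ LLL (A := fun _ => Choice) (perceivedUtility α
      (TargetSet.ofProfile (starProfile p q)) (SimpleGraph.starGraph 0)) := by
  rw [mem_LLL_iff (perceivedUtility_isPotential _ _ _)]
  intro b
  simp only [imposterBonus_ofProfile, welfare_starGraph, Fin.sum_univ_succ, Fin.sum_univ_add,
    starProfile_zero, starProfile_castAdd, starProfile_natAdd]
  have hsum : ∀ (n : ℕ) (f g : Fin n → ℝ) (c : ℝ), (∀ l, f l + g l ≤ c) →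
      ∑ l, f l + ∑ l, g l ≤ n * c := fun n f g c hc => by
    rw [← Finset.sum_add_distrib]
    simpa using Finset.sum_le_sum fun l (_ : l ∈ Finset.univ) => hc l
  cases hb : b 0 with
  | x =>
    have h1 := hsum p (fun l => payoff α Choice.x (b (l.castAdd q).succ))
      (fun l => payoff α Choice.y (b (l.castAdd q).succ)) (1 + α) fun l => by
        cases b (l.castAdd q).succ <;> simp only [payoff] <;> linarith
    have h2 := hsum q (fun l => payoff α Choice.x (b (l.natAdd p).succ))
      (fun l => payoff α Choice.x (b (l.natAdd p).succ)) (2 * (1 + α)) fun l => by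
        cases b (l.natAdd p).succ <;> simp only [payoff] <;> linarith
    simp [payoff] at h1 h2 ⊢
    linarith
  | y =>
    have h1 := hsum p (fun l => payoff α Choice.y (b (l.castAdd q).succ))
      (fun l => payoff α Choice.y (b (l.castAdd q).succ)) 2 fun l => by
        cases b (l.castAdd q).succ <;> simp only [payoff] <;> linarith
    have h2 := hsum q (fun l => payoff α Choice.y (b (l.natAdd p).succ))
      (fun l => payoff α Choice.x (b (l.natAdd p).succ)) (1 + α) fun l => by
        cases b (l.natAdd p).succ <;> simp only [payoff] <;> linarith
    simp [payoff] at h1 h2 ⊢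
    linarith

theorem le_worstBroadRisk {αsys α : ℝ} (hαsys : 0 < αsys) (hα : 0 < α) {p q : ℕ}
    (hpq : 2 ≤ p + q) (h : (1 + α) * (p + q) ≤ 1 + 2 * p) :
    1 - (p : ℝ) / (p + q) * (1 / (1 + αsys)) ≤ worstBroadRisk αsys α := by
  have hpos : (0 : ℝ) < p + q := by exact_mod_cast (by omega : 0 < p + q)
  refine le_csSup_of_le (broadRisks_bddAbove hαsys α) ⟨p + q + 1, by omega, _,
    SimpleGraph.connected_starGraph 0, TargetSet.ofProfile (starProfile p q), rfl⟩ ?_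
  have hx : welfare αsys (SimpleGraph.starGraph 0) (fun _ : Fin (p + q + 1) => Choice.x)
      = 2 * ((p + q) * (1 + αsys)) := by
    simp [welfare_starGraph, payoff]
    ring
  refine le_trans (le_of_eq ?_) (le_broadRisk (αsys := αsys) (b := fun _ => Choice.x)
    (starProfile_mem_LLL hα h) (welfare_nonneg hαsys _ _) (by rw [hx]; positivity))
  rw [hx, welfare_starProfile]
  field_simp

/-- The fixed set on a star in which every leaf is committed to its action in `s`. -/
def FixedSet.leaves {n : ℕ} [NeZero n] (s : Fin (n + 1) → Choice) : FixedSet (n + 1) where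
  Fx := Finset.univ.filter fun i => i ≠ 0 ∧ s i = Choice.x
  Fy := Finset.univ.filter fun i => i ≠ 0 ∧ s i = Choice.y
  disjoint := Finset.disjoint_filter.2 fun i _ h => by simp [h.2]
  nonempty := ⟨Fin.last n, by
    have : Fin.last n ≠ 0 := (Fin.last_pos' (n := n)).ne'
    cases h : s (Fin.last n) <;> simp [h, this]⟩
  strict := by
    rw [Finset.ssubset_univ_iff]
    intro h
    have := Finset.mem_univ (0 : Fin (n + 1))
    rw [← h] at this
    simp at this

theorem FixedSet.leaves_toProfile {n : ℕ} [NeZero n] (s : Fin (n + 1) → Choice)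
    (a : ∀ i, (FixedSet.leaves s).Act i) :
    (FixedSet.leaves s).toProfile a = Function.update s 0 (a 0).1 := by
  funext i
  by_cases hi : i = 0
  · subst hi; simp [FixedSet.toProfile]
  · rw [Function.update_of_ne hi]
    obtain ⟨hx, hy⟩ := (a i).2
    cases h : s i with
    | x => exact hx (by simp [FixedSet.leaves, hi, h])
    | y => exact hy (by simp [FixedSet.leaves, hi, h])

theorem FixedSet.exists_leaves_toProfile {n : ℕ} [NeZero n] (s : Fin (n + 1) → Choice)
    (c : Choice) : ∃ a, (FixedSet.leaves s).toProfile a = Function.update s 0 c := by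
  refine ⟨(FixedSet.leaves s).extend fun _ => c, ?_⟩
  rw [FixedSet.leaves_toProfile]
  congr 1
  simp [FixedSet.extend, FixedSet.leaves]

/-- With all leaves committed, the free center earns `q(1 + α)` from `x` and `p` from `y`. It may
thus settle on `x`, although the true welfare compares `q(1 + αsys)` with `p`. -/
theorem le_worstFocusedRisk {αsys α : ℝ} (hαsys : 0 < αsys) {p q : ℕ}
    (hp : 0 < p) (hq : 0 < q) (h : (p : ℝ) ≤ q * (1 + α)) :
    1 - q * (1 + αsys) / p ≤ worstFocusedRisk αsys α := by
  have : NeZero (p + q) := ⟨by omega⟩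
  refine le_csSup_of_le (focusedRisks_bddAbove hαsys α) ⟨p + q + 1, by omega, _,
    SimpleGraph.connected_starGraph 0, FixedSet.leaves (starProfile p q), rfl⟩ ?_
  obtain ⟨a, ha⟩ := FixedSet.exists_leaves_toProfile (starProfile p q) Choice.x
  obtain ⟨b, hb⟩ := FixedSet.exists_leaves_toProfile (starProfile p q) Choice.y
  have hy : Function.update (starProfile p q) 0 Choice.y = starProfile p q :=
    Function.update_eq_self 0 _
  rw [hy] at hb
  have hp' : (0 : ℝ) < p := Nat.cast_pos.2 hp
  refine le_trans (le_of_eq ?_) (le_focusedRisk (αsys := αsys) (a := a) (b := b) ?_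
    (welfare_nonneg hαsys _ _) ?_)
  · rw [ha, hb, welfare_starProfile, welfare_starProfile_update]
    field_simp
  · rw [mem_focused_LLL_iff, ha]
    intro c
    rw [FixedSet.leaves_toProfile]
    cases (c 0).1
    · exact le_rfl
    · rw [hy, welfare_starProfile, welfare_starProfile_update]
      linarith
  · rw [hb, welfare_starProfile]
    positivity

/-! ### Worst-case risks -/

theorem worstFocusedRisk_nonneg {αsys : ℝ} (h : 0 < αsys) (α : ℝ) :
    0 ≤ worstFocusedRisk αsys α := by
  obtain ⟨r, hr⟩ := focusedRisks_nonempty αsys α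
  refine le_csSup_of_le (focusedRisks_bddAbove h α) hr ?_
  obtain ⟨N, hN, G, -, F, rfl⟩ := hr
  have : NeZero N := ⟨by omega⟩
  exact focusedRisk_nonneg h α F G

theorem worstFocusedRisk_le {αsys α : ℝ} (hαsys : 0 < αsys) (hα : αsys ≤ α) :
    worstFocusedRisk αsys α ≤ 1 - (1 + αsys) / (1 + α) := by
  refine csSup_le (focusedRisks_nonempty αsys α) ?_
  rintro _ ⟨N, hN, G, hG, F, rfl⟩
  exact focusedRisk_le hαsys hα hN hG F

theorem worstFocusedRisk_strictMonoOn {αsys : ℝ} (hαsys : 0 < αsys) :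
    StrictMonoOn (worstFocusedRisk αsys) (Set.Ici αsys) := by
  intro α₁ h₁ α₂ _ h
  rw [Set.mem_Ici] at h₁
  -- `r` is the ratio of `y`-leaves to `x`-leaves: at most `1 + α₂`, so the center can be misled at
  -- gain `α₂`, and above `1 + α₁`, so the loss beats the upper bound at `α₁`.
  obtain ⟨r, hr₁, hr₂⟩ := exists_rat_btwn (show 1 + α₁ < 1 + α₂ by linarith)
  have hr : (0 : ℝ) < r := by linarith
  have hden : (0 : ℝ) < r.den := Nat.cast_pos.2 r.den_pos
  have hnum : 0 < r.num := Rat.num_pos.2 (by exact_mod_cast hr)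
  have hcast : ((r.num.toNat : ℕ) : ℝ) = r * r.den := by
    have h1 : ((r.num.toNat : ℕ) : ℝ) = ((r.num.toNat : ℤ) : ℝ) := by push_cast; rfl
    rw [h1, Int.toNat_of_nonneg hnum.le]
    exact_mod_cast (Rat.mul_den_eq_num r).symm
  refine (worstFocusedRisk_le hαsys h₁).trans_lt (lt_of_lt_of_le ?_
    (le_worstFocusedRisk (p := r.num.toNat) (q := r.den) hαsys (by omega) r.den_pos ?_))
  · rw [hcast, mul_comm, mul_div_mul_right _ _ hden.ne']
    exact sub_lt_sub_left (div_lt_div_of_pos_left (by linarith) (by linarith) hr₁) 1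
  · rw [hcast, mul_comm]
    exact mul_le_mul_of_nonneg_left hr₂.le hden.le

/-! ### Gain thresholds for the broad risk. -/

theorem le_worstBroadRisk_of_le_div {αsys α : ℝ} (hαsys : 0 < αsys) (hα : 0 < α) {k : ℕ}
    (hk : 1 ≤ k) (h : α ≤ (k : ℝ) / (k + 1)) :
    1 - (k : ℝ) / (k + 1) * (1 / (1 + αsys)) ≤ worstBroadRisk αsys α := by
  -- With a single `x`-leaf the stability condition reads `α * (k + 1) ≤ k`.
  have h' := le_worstBroadRisk hαsys hα (p := k) (q := 1) (by omega) (by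
    rw [le_div_iff₀ (by positivity)] at h
    push_cast
    linarith)
  simpa using h'

theorem le_worstBroadRisk_of_le_three_halves {αsys α : ℝ} (hαsys : 0 < αsys) (hα : 0 < α)
    (h : α ≤ 3 / 2) : 1 - 1 / (1 + αsys) ≤ worstBroadRisk αsys α := by
  -- Without `x`-leaves the condition is `α ≤ 1 + 1 / p`. Since `N ≥ 3` forces `p ≥ 2`, the largest
  -- threshold is `3 / 2`.
  have h' := le_worstBroadRisk hαsys hα (p := 2) (q := 0) le_rfl (by push_cast; linarith)
  norm_num at h' ⊢
  exact h'

theorem exists_le_natCast_div {α : ℝ} (h : α < 1) : ∃ k : ℕ, 1 ≤ k ∧ α ≤ (k : ℝ) / (k + 1) := by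
  obtain ⟨n, hn⟩ := exists_nat_gt (1 / (1 - α))
  rw [div_lt_iff₀ (by linarith)] at hn
  refine ⟨n + 1, by omega, ?_⟩
  rw [le_div_iff₀ (by positivity)]
  push_cast
  nlinarith

end CoordGame

theorem corollary2 (αsys : ℝ) (hαsys : 0 < αsys) (γ : ℝ) (hγ : γ ∈ Set.Icc (0 : ℝ) 1)
    (α : ℝ) (hα : 0 < α) (hrisk : CoordGame.worstBroadRisk αsys α ≤ γ) :
    (∀ ksys : ℕ, 1 ≤ ksys → αsys ∈ CoordGame.gainInterval ksys →
      (γ ∈ Set.Icc (1 - (ksys : ℝ) / (ksys + 1) * (1 / (1 + αsys))) 1 →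
        0 ≤ CoordGame.worstFocusedRisk αsys α) ∧
      (∀ k : ℕ, ksys ≤ k →
        γ ∈ Set.Ico (1 - ((k : ℝ) + 1) / (k + 2) * (1 / (1 + αsys)))
          (1 - (k : ℝ) / (k + 1) * (1 / (1 + αsys))) →
        CoordGame.worstFocusedRisk αsys ((k : ℝ) / (k + 1)) <
          CoordGame.worstFocusedRisk αsys α) ∧
      (γ = 1 - 1 / (1 + αsys) →
        CoordGame.worstFocusedRisk αsys 1 ≤ CoordGame.worstFocusedRisk αsys α) ∧
      (γ ∈ Set.Ico 0 (1 - 1 / (1 + αsys)) →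
        CoordGame.worstFocusedRisk αsys (3 / 2) < CoordGame.worstFocusedRisk αsys α)) ∧
    (αsys ∈ Set.Icc (1 : ℝ) (3 / 2) →
      (γ ∈ Set.Icc (1 - 1 / (1 + αsys)) 1 → 0 ≤ CoordGame.worstFocusedRisk αsys α) ∧
      (γ ∈ Set.Ico 0 (1 - 1 / (1 + αsys)) →
        CoordGame.worstFocusedRisk αsys (3 / 2) < CoordGame.worstFocusedRisk αsys α)) ∧
    (3 / 2 < αsys → 0 ≤ CoordGame.worstFocusedRisk αsys α) := by
  have hnn := CoordGame.worstFocusedRisk_nonneg hαsys α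
  have hmono : ∀ α₀, αsys ≤ α₀ → α₀ < α →
      CoordGame.worstFocusedRisk αsys α₀ < CoordGame.worstFocusedRisk αsys α := fun α₀ h₀ h =>
    CoordGame.worstFocusedRisk_strictMonoOn hαsys h₀ (h₀.trans h.le) h
  have hlarge : γ ∈ Set.Ico 0 (1 - 1 / (1 + αsys)) → 3 / 2 < α := fun h => by
    by_contra! hle
    exact (CoordGame.le_worstBroadRisk_of_le_three_halves hαsys hα hle).not_gt
      (hrisk.trans_lt h.2)
  refine ⟨fun ksys hk hsys => ?_, fun hsys => ⟨fun _ => hnn, fun h =>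
    hmono _ hsys.2 (hlarge h)⟩, fun _ => hnn⟩
  have hlt_one : ∀ k : ℕ, (k : ℝ) / (k + 1) < 1 := fun k => by
    rw [div_lt_one (by positivity)]
    linarith
  have hsys_lt : αsys < 1 := hsys.2.trans_lt (hlt_one ksys)
  refine ⟨fun _ => hnn, fun k hkk h => hmono _ ?_ ?_, fun h => ?_, fun h =>
    hmono _ (by linarith) (hlarge h)⟩
  · refine hsys.2.trans ?_
    have : (ksys : ℝ) ≤ k := Nat.cast_le.2 hkk
    rw [div_le_div_iff₀ (by positivity) (by positivity)]
    linarith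
  · by_contra! hle
    exact (CoordGame.le_worstBroadRisk_of_le_div hαsys hα (hk.trans hkk) hle).not_gt
      (hrisk.trans_lt h.2)
  -- Each `α < 1` lies below some `k / (k + 1)`, where the broad risk already exceeds this
  -- borderline budget. The value `α = 1` is not excluded, so the resulting inequality is not
  -- strict.
  · have hone : 1 ≤ α := by
      by_contra! hlt
      obtain ⟨k, hk1, hle⟩ := CoordGame.exists_le_natCast_div hlt
      have h1 := (CoordGame.le_worstBroadRisk_of_le_div hαsys hα hk1 hle).trans (hrisk.trans_eq h)
      have h2 : (k : ℝ) / (k + 1) * (1 / (1 + αsys)) < 1 * (1 / (1 + αsys)) :=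
        mul_lt_mul_of_pos_right (hlt_one k) (by positivity)
      linarith
    rcases hone.eq_or_lt with rfl | hlt
    · exact le_rfl
    · exact (hmono 1 hsys_lt.le hlt).le
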